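/- For a field $F$ and integers $d,k\ge 1$, equip $F^d$ with the standard bilinear form $\langle u,v\rangle=\sum_{i=1}^d u_iv_i$; call $u,v$ orthogonal if $\langle u,v\rangle=0$, and call $u$ non-self-orthogonal if $\langle u,u\rangle\neq 0$. Let $\alpha(d,k,F)$ be the largest size of a set $A\subseteq F^d$ of non-self-orthogonal vectors such that any $k+1$ vectors of $A$ include an orthogonal pair. Let $\beta(d,k,F)$ be the largest size of a set $A\subseteq F^d$ of non-self-orthogonal vectors such that for any two (not necessarily disjoint) subsets $A_1,A_2\subseteq A$ of size $k+1$ each there are $v_1\in A_1$ and $v_2\in A_2$ with $\langle v_1,v_2\rangle=0$. Logarithms are in base $2$. **Theorem.** For every prime $p$ there is $\delta=\delta(p)>0$ such that for every field $F$ of characteristic $p$ and all integers $k\ge 2$ and $d\ge k$, $$\beta(d,k,F)\ \ge\ d^{\,\delta k/\log k}.$$ So there is a set of at least that many non-self-orthogonal vectors in $F^d$ such that any two (not necessarily disjoint) $(k+1)$-subsets contain a mutually orthogonal cross pair. In particular, $\alpha(d,k,F)\ge\beta(d,k,F)\ge d^{\,\delta k/\log k}$. This bound on $\alpha$ is optimal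 up to the $\log k$ term in the exponent, since $$\alpha(d,k,F)\ <\ \binom{d+k}{k}\ \le\ d^{\,2k}.$$ -/

import Mathlib

open scoped ENNReal Matrix

/-- A set of vectors of `F ^ d` is `k`-nearly orthogonal if its members are non-self-orthogonal
(with respect to the standard bilinear form `u ⬝ᵥ v = ∑ i, u i * v i`) and any `k + 1` of its
members include an orthogonal pair. -/
def IsNearlyOrthogonal {F : Type*} [Field F] {d : ℕ} (k : ℕ) (A : Set (Fin d → F)) : Prop :=
  (∀ v ∈ A, v ⬝ᵥ v ≠ 0) ∧
    ∀ S : Finset (Fin d → F), (S : Set (Fin d → F)) ⊆ A → S.card = k + 1 →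
      ∃ u ∈ S, ∃ v ∈ S, u ≠ v ∧ u ⬝ᵥ v = 0

/-- The bipartite variant: the members are non-self-orthogonal, and for any two (not necessarily
disjoint) subsets of size `k + 1`, some vector of the first is orthogonal to some vector of the
second. -/
def IsBipartiteNearlyOrthogonal {F : Type*} [Field F] {d : ℕ} (k : ℕ)
    (A : Set (Fin d → F)) : Prop :=
  (∀ v ∈ A, v ⬝ᵥ v ≠ 0) ∧
    ∀ S₁ S₂ : Finset (Fin d → F), (S₁ : Set (Fin d → F)) ⊆ A → (S₂ : Set (Fin d → F)) ⊆ A →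
      S₁.card = k + 1 → S₂.card = k + 1 → ∃ u ∈ S₁, ∃ v ∈ S₂, u ⬝ᵥ v = 0

/-- `α(d, k, F)`: the largest size of a `k`-nearly orthogonal subset of `F ^ d`, as a supremum in
the extended natural numbers. -/
noncomputable def nearlyOrthogonalNumber (d k : ℕ) (F : Type*) [Field F] : ℕ∞ :=
  ⨆ A : {A : Set (Fin d → F) // IsNearlyOrthogonal k A}, A.1.encard

/-- `β(d, k, F)`: the largest size of a subset of `F ^ d` with the bipartite property, as a
supremum in the extended natural numbers. -/
noncomputable def bipartiteNearlyOrthogonalNumber (d k : ℕ) (F : Type*) [Field F] : ℕ∞ :=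
  ⨆ A : {A : Set (Fin d → F) // IsBipartiteNearlyOrthogonal k A}, A.1.encard

/-! The upper bound is Ramsey's theorem in the Erdős–Szekeres form: pairwise orthogonal,
non-self-orthogonal vectors are independent, so a clique of the orthogonality graph has at most `d`
members.

The lower bound is probabilistic. Let `q = p`, `h = k / 2`, and let `t` be maximal with `k ^ t ≤ d`.
Take random tensor products of `t` non-self-orthogonal vectors of the prime field's `k`-dimensional
space. Inner products of tensors multiply, so a nonzero one needs `t` nonzero factors. In a single
factor, two random `h`-tuples have no orthogonal cross pair with probability at most `2^h q^(2h) (1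
- 1/q)^(h²)` (`card_cross_nonorthogonal_le`); for tensors this is raised to the power `t`. A union
bound (`exists_seq_forall_exists_not_rel`) then allows a sequence of length exponential in `k t`,
and `t` is of order `log d / log k`. Bounded `k` is covered by the standard basis. -/

/-! ### Upper bound on `α` by Ramsey's theorem. -/

theorem exists_clique_or_independent {α : Type*} [DecidableEq α] {r : α → α → Prop}
    (hr : ∀ u v, r u v → r v u) (a b : ℕ) (S : Finset α) (hS : (a + b).choose a ≤ S.card) :
    (∃ T ⊆ S, T.card = a + 1 ∧ (T : Set α).Pairwise r) ∨
      ∃ T ⊆ S, T.card = b + 1 ∧ (T : Set α).Pairwise fun u v => ¬ r u v := by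
  classical
  induction a generalizing b S with
  | zero =>
    obtain ⟨v, hv⟩ : S.Nonempty := Finset.card_pos.1 (by simpa using hS)
    exact Or.inl ⟨{v}, by simpa using hv, by simp, by simp⟩
  | succ a iha =>
    induction b generalizing S with
    | zero =>
      obtain ⟨v, hv⟩ : S.Nonempty := Finset.card_pos.1 ((Nat.choose_pos (by omega)).trans_le hS)
      exact Or.inr ⟨{v}, by simpa using hv, by simp, by simp⟩
    | succ b ihb =>
      have hchoose : (a + 1 + (b + 1)).choose (a + 1) =
          (a + (b + 1)).choose a + (a + 1 + b).choose (a + 1) := by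
        rw [show a + 1 + (b + 1) = (a + (b + 1)) + 1 by ring, Nat.choose_succ_succ]
        congr 2; ring
      have hpos : 0 < (a + (b + 1)).choose a := Nat.choose_pos (by omega)
      obtain ⟨v, hv⟩ : S.Nonempty := Finset.card_pos.1 (by omega)
      have hsplit := Finset.card_filter_add_card_filter_not (s := S.erase v) (fun u => r v u)
      have herase := Finset.card_erase_add_one hv
      have hsub : ∀ (P : α → Prop) [DecidablePred P], (S.erase v).filter P ⊆ S := fun P _ =>
        (Finset.filter_subset _ _).trans (Finset.erase_subset _ _)
      -- By Pascal's rule, either the neighbours or the non-neighbours of `v` are numerous enough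
      -- for induction, and `v` extends the set found there.
      by_cases hN : (a + (b + 1)).choose a ≤ ((S.erase v).filter fun u => r v u).card
      · rcases iha (b + 1) _ hN with ⟨T, hTS, hT, hc⟩ | ⟨T, hTS, hT, hc⟩
        · refine Or.inl ⟨insert v T, ?_, ?_, ?_⟩
          · exact Finset.insert_subset hv (hTS.trans (hsub _))
          · rw [Finset.card_insert_of_notMem, hT]
            intro h; simpa using hTS h
          · rw [Finset.coe_insert]
            refine hc.insert fun u hu _ => ?_
            have := (Finset.mem_filter.1 (hTS hu)).2
            exact ⟨this, hr _ _ this⟩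
        · exact Or.inr ⟨T, hTS.trans (hsub _), hT, hc⟩
      · have hM : (a + 1 + b).choose (a + 1) ≤ ((S.erase v).filter fun u => ¬ r v u).card := by
          omega
        rcases ihb _ hM with ⟨T, hTS, hT, hc⟩ | ⟨T, hTS, hT, hc⟩
        · exact Or.inl ⟨T, hTS.trans (hsub _), hT, hc⟩
        · refine Or.inr ⟨insert v T, ?_, ?_, ?_⟩
          · exact Finset.insert_subset hv (hTS.trans (hsub _))
          · rw [Finset.card_insert_of_notMem, hT]
            intro h; simpa using hTS h
          · rw [Finset.coe_insert]
            refine hc.insert fun u hu _ => ?_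
            have := (Finset.mem_filter.1 (hTS hu)).2
            exact ⟨this, fun h => this (hr _ _ h)⟩

theorem card_le_of_pairwise_orthogonal {F : Type*} [Field F] {d : ℕ} (T : Finset (Fin d → F))
    (hT : ∀ v ∈ T, v ⬝ᵥ v ≠ 0) (hp : (T : Set (Fin d → F)).Pairwise fun u v => u ⬝ᵥ v = 0) :
    T.card ≤ d := by
  have hli : LinearIndependent F (fun v : T => (v : Fin d → F)) := by
    rw [Fintype.linearIndependent_iff]
    intro g hg v
    have h0 : (∑ u : T, g u • (u : Fin d → F)) ⬝ᵥ (v : Fin d → F) = 0 := by rw [hg]; simp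
    rw [sum_dotProduct, Finset.sum_eq_single v] at h0
    · rw [smul_dotProduct, smul_eq_mul] at h0
      exact (mul_eq_zero.1 h0).resolve_right (hT v v.2)
    · intro u _ huv
      rw [smul_dotProduct, hp u.2 v.2 (fun h => huv (Subtype.ext h)), smul_zero]
    · simp
  simpa using hli.fintype_card_le_finrank

theorem IsNearlyOrthogonal.card_lt {F : Type*} [Field F] {d k : ℕ} {A : Set (Fin d → F)}
    (hA : IsNearlyOrthogonal k A) (S : Finset (Fin d → F)) (hS : (S : Set (Fin d → F)) ⊆ A) :
    S.card < (d + k).choose k := by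
  classical
  by_contra! hcard
  rw [Nat.choose_symm_add.symm] at hcard
  rcases exists_clique_or_independent (r := fun u v : Fin d → F => u ⬝ᵥ v = 0)
    (fun u v h => (dotProduct_comm v u).trans h) d k S hcard with
    ⟨T, hTS, hT, hc⟩ | ⟨T, hTS, hT, hc⟩
  · have := card_le_of_pairwise_orthogonal T (fun v hv => hA.1 v (hS (hTS hv))) hc
    omega
  · obtain ⟨u, hu, v, hv, huv, h0⟩ := hA.2 T (fun v hv => hS (hTS hv)) hT
    exact hc hu hv huv h0

theorem IsNearlyOrthogonal.encard_lt {F : Type*} [Field F] {d k : ℕ} {A : Set (Fin d → F)}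
    (hA : IsNearlyOrthogonal k A) : A.encard < (((d + k).choose k : ℕ) : ℕ∞) := by
  by_contra! h
  obtain ⟨T, hTA, hT⟩ := Set.exists_subset_encard_eq h
  have hfin : T.Finite := Set.finite_of_encard_eq_coe hT
  have hcard := hA.card_lt hfin.toFinset (by simpa using hTA)
  rw [hfin.encard_eq_coe_toFinset_card] at hT
  have : hfin.toFinset.card = (d + k).choose k := by exact_mod_cast hT
  omega

theorem nearlyOrthogonalNumber_lt (d k : ℕ) (F : Type*) [Field F] :
    nearlyOrthogonalNumber d k F < (((d + k).choose k : ℕ) : ℕ∞) := by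
  have hpos : 0 < (d + k).choose k := Nat.choose_pos (by omega)
  obtain ⟨c, hc⟩ := Nat.exists_eq_succ_of_ne_zero hpos.ne'
  -- A supremum need not inherit a strict bound, so each set is bounded by the predecessor `c`.
  have hle : nearlyOrthogonalNumber d k F ≤ (c : ℕ∞) := by
    refine iSup_le fun A => ?_
    have := A.2.encard_lt
    rw [hc, Nat.cast_succ] at this
    exact Order.le_of_lt_add_one this
  refine hle.trans_lt ?_
  rw [hc]
  exact_mod_cast Nat.lt_succ_self c

theorem choose_add_le_pow {d k : ℕ} (hd : 2 ≤ d) : (d + k).choose k ≤ d ^ (2 * k) := by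
  have h1 : (d + k).choose k ≤ (d + 1) ^ k := by
    induction k with
    | zero => simp
    | succ k ih =>
      have h := Nat.add_one_mul_choose_eq (d + k) k
      have h2 : (d + (k + 1)).choose (k + 1) * (k + 1) ≤
          ((d + 1) ^ (k + 1)) * (k + 1) := by
        rw [show d + (k + 1) = d + k + 1 by ring, ← h, pow_succ]
        nlinarith [Nat.mul_le_mul ih (show d + k + 1 ≤ (d + 1) * (k + 1) by nlinarith)]
      exact Nat.le_of_mul_le_mul_right h2 (by omega)
  refine h1.trans ?_
  rw [pow_mul]
  -- `d + 1 ≤ d ^ 2` is where `2 ≤ d` enters.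
  exact Nat.pow_le_pow_left (by nlinarith) k

/-! ### Comparison of `β` with `α`, and the standard basis. -/

theorem IsBipartiteNearlyOrthogonal.isNearlyOrthogonal {F : Type*} [Field F] {d k : ℕ}
    {A : Set (Fin d → F)} (hA : IsBipartiteNearlyOrthogonal k A) : IsNearlyOrthogonal k A := by
  refine ⟨hA.1, fun S hS hcard => ?_⟩
  obtain ⟨u, hu, v, hv, h⟩ := hA.2 S S hS hS hcard hcard
  refine ⟨u, hu, v, hv, ?_, h⟩
  rintro rfl
  exact hA.1 u (hS hu) h

theorem bipartiteNearlyOrthogonalNumber_le (d k : ℕ) (F : Type*) [Field F] :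
    bipartiteNearlyOrthogonalNumber d k F ≤ nearlyOrthogonalNumber d k F :=
  iSup_le fun A => le_iSup (fun A : {A : Set (Fin d → F) // IsNearlyOrthogonal k A} => A.1.encard)
    ⟨A.1, A.2.isNearlyOrthogonal⟩

theorem IsBipartiteNearlyOrthogonal.card_le_number {F : Type*} [Field F] {d k : ℕ}
    {A : Finset (Fin d → F)} (hA : IsBipartiteNearlyOrthogonal k (A : Set (Fin d → F))) :
    (A.card : ℕ∞) ≤ bipartiteNearlyOrthogonalNumber d k F := by
  rw [← Set.encard_coe_eq_coe_finsetCard]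
  exact le_iSup (fun A : {A : Set (Fin d → F) // IsBipartiteNearlyOrthogonal k A} => A.1.encard)
    ⟨A, hA⟩

theorem exists_bipartiteNearlyOrthogonal_card_eq_dim (F : Type*) [Field F] (d k : ℕ) (hk : 1 ≤ k) :
    ∃ A : Finset (Fin d → F), IsBipartiteNearlyOrthogonal k (A : Set (Fin d → F)) ∧
      A.card = d := by
  classical
  refine ⟨Finset.univ.image fun i => Pi.single i (1 : F), ⟨?_, ?_⟩, ?_⟩
  · simp
  · intro S₁ S₂ h₁ h₂ c₁ c₂
    obtain ⟨u, hu⟩ : S₁.Nonempty := Finset.card_pos.1 (by omega)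
    obtain ⟨v, hv, huv⟩ := Finset.exists_mem_ne (s := S₂) (by omega) u
    refine ⟨u, hu, v, hv, ?_⟩
    obtain ⟨i, -, rfl⟩ := Finset.mem_image.1 (h₁ hu)
    obtain ⟨j, -, rfl⟩ := Finset.mem_image.1 (h₂ hv)
    have hij : i ≠ j := by rintro rfl; exact huv rfl
    simp [hij]
  · rw [Finset.card_image_of_injective, Finset.card_univ, Fintype.card_fin]
    intro i j hij
    by_contra hne
    have := congrFun hij i
    simp [hne] at this

/-! ### Counting tuples without orthogonal cross pairs. -/

/-- The number of vectors non-orthogonal to each member of a linearly independent family. -/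
theorem card_forall_dotProduct_ne_zero {K ι : Type*} [Field K] [Fintype K] [DecidableEq K]
    [Fintype ι] {m : ℕ} {x : ι → Fin m → K} (hx : LinearIndependent K x) :
    (Finset.univ.filter fun y : Fin m → K => ∀ i, x i ⬝ᵥ y ≠ 0).card *
        Fintype.card K ^ Fintype.card ι =
      Fintype.card K ^ m * (Fintype.card K - 1) ^ Fintype.card ι := by
  classical
  let L : (Fin m → K) →ₗ[K] (ι → K) := (Matrix.of x).mulVecLin
  have hL : ∀ y i, L y i = x i ⬝ᵥ y := fun _ _ => rfl
  -- Independent rows make `L` onto, so all its fibres have the same size `c` and the inner products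
  -- are equidistributed.
  have hsurj : Function.Surjective L := by
    rw [← LinearMap.range_eq_top]
    apply Submodule.eq_top_of_finrank_eq
    have := LinearIndependent.rank_matrix (M := Matrix.of x) hx
    rw [Module.finrank_fintype_fun_eq_card]
    exact this
  have hfib : ∀ z : ι → K, (Finset.univ.filter fun y => L y = z).card =
      (Finset.univ.filter fun y => L y = 0).card := by
    intro z
    exact AddMonoidHom.card_fiber_eq_of_mem_range L.toAddMonoidHom (hsurj z) (hsurj 0)
  set c := (Finset.univ.filter fun y => L y = 0).card with hc
  have htot : Fintype.card K ^ m = Fintype.card K ^ Fintype.card ι * c := by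
    have := Finset.card_eq_sum_card_fiberwise (s := Finset.univ) (t := Finset.univ) (f := L)
      (fun _ _ => Finset.mem_coe.2 (Finset.mem_univ _))
    simp only [hfib, Finset.sum_const, Finset.card_univ, Fintype.card_pi, Finset.prod_const,
      smul_eq_mul, Fintype.card_fin] at this
    exact this
  have hgood : (Finset.univ.filter fun y : Fin m → K => ∀ i, x i ⬝ᵥ y ≠ 0).card =
      (Fintype.card K - 1) ^ Fintype.card ι * c := by
    have hmaps : Set.MapsTo L (Finset.univ.filter fun y : Fin m → K => ∀ i, x i ⬝ᵥ y ≠ 0)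
        (Fintype.piFinset fun _ : ι => (Finset.univ.erase (0 : K))) := by
      intro y hy
      simpa [Fintype.mem_piFinset, hL] using hy
    rw [Finset.card_eq_sum_card_fiberwise hmaps, Finset.sum_congr rfl (g := fun _ => c)]
    · simp [Fintype.card_piFinset, Finset.card_erase_of_mem]
    · intro z hz
      rw [← hfib z, Finset.filter_filter]
      congr 1
      ext y
      simp only [Finset.mem_filter, Finset.mem_univ, true_and, and_iff_right_iff_imp]
      rintro rfl
      simpa [Fintype.mem_piFinset, hL] using hz
  rw [hgood, htot]
  ring

/-- The number of families all of whose members lie in the span of the members indexed by `I`. -/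
theorem card_forall_mem_span_le {K ι : Type*} [Field K] [Fintype K] [DecidableEq K]
    [Fintype ι] [DecidableEq ι] (m : ℕ) (I : Finset ι)
    [DecidablePred fun x : ι → Fin m → K => ∀ j, x j ∈ Submodule.span K (x '' I)] :
    (Finset.univ.filter fun x : ι → Fin m → K =>
        ∀ j, x j ∈ Submodule.span K (x '' I)).card ≤
      Fintype.card K ^ (m * I.card) *
        Fintype.card K ^ (I.card * (Fintype.card ι - I.card)) := by
  classical
  let φ : (I → Fin m → K) × ({j // j ∉ I} → I → K) → ι → Fin m → K := fun z j =>
    if hj : j ∈ I then z.1 ⟨j, hj⟩ else ∑ i : I, z.2 ⟨j, hj⟩ i • z.1 i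
  have hsub : (Finset.univ.filter fun x : ι → Fin m → K =>
      ∀ j, x j ∈ Submodule.span K (x '' I)) ⊆ Finset.univ.image φ := by
    intro x hx
    rw [Finset.mem_filter] at hx
    have hspan : ∀ j, ∃ c : I → K, ∑ i : I, c i • x i = x j := by
      intro j
      have h := hx.2 j
      rw [Set.image_eq_range] at h
      exact (Submodule.mem_span_range_iff_exists_fun K).1 h
    choose c hc using hspan
    refine Finset.mem_image.2 ⟨(fun i => x i, fun j => c j), Finset.mem_univ _, ?_⟩
    funext j
    by_cases hj : j ∈ I
    · simp [φ, hj]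
    · simp only [φ, hj, dite_false]
      exact hc j
  refine (Finset.card_le_card hsub).trans (Finset.card_image_le.trans (le_of_eq ?_))
  simp only [Finset.card_univ, Fintype.card_prod, Fintype.card_pi, Finset.prod_const,
    Fintype.card_coe, Fintype.card_fin, ← pow_mul, Fintype.card_subtype_compl]

theorem exists_basis_indices {K ι M : Type*} [Field K] [AddCommGroup M] [Module K M] [Fintype ι]
    (x : ι → M) : ∃ I : Finset ι, LinearIndependent K (fun i : I => x i) ∧
      ∀ j, x j ∈ Submodule.span K (x '' I) := by
  classical
  obtain ⟨s, hs⟩ := exists_maximal_linearIndepOn K x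
  refine ⟨s.toFinset, ?_, fun j => ?_⟩
  · have := hs.1
    rw [LinearIndepOn] at this
    exact this.comp (fun i : s.toFinset => ⟨i, Set.mem_toFinset.1 i.2⟩)
      (fun a b h => Subtype.ext (by simpa using h))
  · rw [Set.coe_toFinset]
    by_cases hj : j ∈ s
    · exact Submodule.subset_span ⟨j, hj, rfl⟩
    · obtain ⟨a, ha, hmem⟩ := hs.2 j hj
      rwa [Submodule.smul_mem_iff _ ha] at hmem

/-- The number of pairs of `h`-tuples of vectors without an orthogonal cross pair. -/
theorem card_cross_nonorthogonal_le {K : Type*} [Field K] [Fintype K] [DecidableEq K]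
    {m h : ℕ} (hm : 2 * h ≤ m) :
    (Finset.univ.filter fun z : (Fin h → Fin m → K) × (Fin h → Fin m → K) =>
        ∀ i j, z.1 i ⬝ᵥ z.2 j ≠ 0).card * Fintype.card K ^ (h * h) ≤
      2 ^ h * (Fintype.card K ^ (2 * m * h) * (Fintype.card K - 1) ^ (h * h)) := by
  classical
  set q := Fintype.card K with hq
  have hq1 : 1 < q := Fintype.one_lt_card
  let Y : Finset (Fin h) → (Fin h → Fin m → K) → Finset (Fin m → K) := fun I x =>
    Finset.univ.filter fun y => ∀ i : I, x i ⬝ᵥ y ≠ 0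
  let X : Finset (Fin h) → Finset (Fin h → Fin m → K) := fun I =>
    Finset.univ.filter fun x => LinearIndependent K (fun i : I => x i) ∧
      ∀ j, x j ∈ Submodule.span K (x '' I)
  have hY : ∀ I, ∀ x ∈ X I, (Y I x).card * q ^ I.card = q ^ m * (q - 1) ^ I.card := by
    intro I x hx
    have := card_forall_dotProduct_ne_zero (Finset.mem_filter.1 hx).2.1
    rwa [Fintype.card_coe] at this
  have hX : ∀ I, (X I).card ≤ q ^ (m * I.card) * q ^ (I.card * (h - I.card)) := by
    intro I
    refine (Finset.card_le_card ?_).trans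
      ((card_forall_mem_span_le (K := K) m I).trans (by simp [hq]))
    intro x hx
    simp only [X, Finset.mem_filter] at hx ⊢
    exact ⟨hx.1, hx.2.2⟩
  have hcover : (Finset.univ.filter fun z : (Fin h → Fin m → K) × (Fin h → Fin m → K) =>
        ∀ i j, z.1 i ⬝ᵥ z.2 j ≠ 0) ⊆
      (Finset.univ : Finset (Finset (Fin h))).biUnion fun I => ((X I).sigma fun x =>
        Fintype.piFinset fun _ : Fin h => Y I x).image fun w => (w.1, w.2) := by
    rintro ⟨x, y⟩ hz
    rw [Finset.mem_filter] at hz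
    obtain ⟨I, hI, hspan⟩ := exists_basis_indices (K := K) x
    refine Finset.mem_biUnion.2 ⟨I, Finset.mem_univ _, Finset.mem_image.2 ⟨⟨x, y⟩, ?_, rfl⟩⟩
    refine Finset.mem_sigma.2 ⟨Finset.mem_filter.2 ⟨Finset.mem_univ _, hI, hspan⟩,
      Fintype.mem_piFinset.2 fun j => ?_⟩
    simp only [Y, Finset.mem_filter, Finset.mem_univ, true_and]
    exact fun i => hz.2 i j
  have hterm : ∀ I : Finset (Fin h), (((X I).sigma fun x =>
        Fintype.piFinset fun _ : Fin h => Y I x).image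
          fun w => ((w.1, w.2) : (Fin h → Fin m → K) × (Fin h → Fin m → K))).card * q ^ (h * h) ≤
      q ^ (2 * m * h) * (q - 1) ^ (h * h) := by
    intro I
    obtain ⟨s, hs⟩ : ∃ s, I.card = s := ⟨_, rfl⟩
    have hsh : s ≤ h := by simpa [hs] using Finset.card_le_univ I
    have hYs := hY I
    have hXs := hX I
    rw [hs] at hXs
    simp only [hs] at hYs
    have h1 : (((X I).sigma fun x =>
        Fintype.piFinset fun _ : Fin h => Y I x).image
          fun w => ((w.1, w.2) : (Fin h → Fin m → K) × (Fin h → Fin m → K))).card * q ^ (s * h) ≤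
        q ^ (m * s) * q ^ (s * (h - s)) * (q ^ (m * h) * (q - 1) ^ (s * h)) := by
      refine (Nat.mul_le_mul_right _ Finset.card_image_le).trans ?_
      rw [Finset.card_sigma, Finset.sum_mul]
      refine (Finset.sum_le_card_nsmul _ _ (q ^ (m * h) * (q - 1) ^ (s * h)) ?_).trans ?_
      · intro x hx
        rw [Fintype.card_piFinset, Finset.prod_const, Finset.card_univ, Fintype.card_fin, pow_mul,
          ← mul_pow, hYs x hx, mul_pow, ← pow_mul, ← pow_mul]
      · rw [smul_eq_mul]
        exact Nat.mul_le_mul_right _ hXs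
    clear hYs hXs
    generalize (((X I).sigma fun x =>
        Fintype.piFinset fun _ : Fin h => Y I x).image
          fun w => ((w.1, w.2) : (Fin h → Fin m → K) × (Fin h → Fin m → K))).card = N at h1 ⊢
    clear hcover hX hY hs X Y
    -- `a` is the rank deficiency of the first tuple. Such tuples are rare enough to pay for the
    -- missing conditions: the exponents of `q` in `h4` differ by `a * (a + c)`.
    obtain ⟨a, rfl⟩ := Nat.exists_eq_add_of_le hsh
    obtain ⟨c, rfl⟩ := Nat.exists_eq_add_of_le hm
    have h2 := Nat.mul_le_mul_right (q ^ (a * (s + a))) h1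
    rw [mul_assoc, ← pow_add] at h2
    rw [show (s + a) * (s + a) = s * (s + a) + a * (s + a) by ring]
    refine h2.trans ?_
    rw [pow_add (q - 1)]
    have h3 : 1 ≤ (q - 1) ^ (a * (s + a)) := Nat.one_le_pow _ _ (by omega)
    have h4 : q ^ ((2 * (s + a) + c) * s) * q ^ (s * (s + a - s)) * q ^ ((2 * (s + a) + c) * (s + a))
        * q ^ (a * (s + a)) ≤ q ^ (2 * (2 * (s + a) + c) * (s + a)) := by
      rw [← pow_add, ← pow_add, ← pow_add, Nat.add_sub_cancel_left]
      exact Nat.pow_le_pow_right (by omega)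
        (by nlinarith [Nat.zero_le (a * c), Nat.zero_le (a * a), Nat.zero_le (a * s)])
    calc _ = (q ^ ((2 * (s + a) + c) * s) * q ^ (s * (s + a - s)) *
          q ^ ((2 * (s + a) + c) * (s + a)) * q ^ (a * (s + a))) * ((q - 1) ^ (s * (s + a)) * 1) := by
            ring
      _ ≤ _ := Nat.mul_le_mul h4 (Nat.mul_le_mul_left _ h3)
  refine (Nat.mul_le_mul_right _ ((Finset.card_le_card hcover).trans
    Finset.card_biUnion_le)).trans ?_
  rw [Finset.sum_mul]
  refine (Finset.sum_le_card_nsmul _ _ _ fun I _ => hterm I).trans ?_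
  -- The factor `2 ^ h` counts the index sets `I`.
  simp

/-- Every vector of `K ^ m` becomes non-self-orthogonal after prepending `0` or `1`, in any
characteristic. -/
theorem pow_le_card_nonselforthogonal (K : Type*) [Field K] [Fintype K] [DecidableEq K] (m : ℕ) :
    Fintype.card K ^ m ≤ Fintype.card {v : Fin (m + 1) → K // v ⬝ᵥ v ≠ 0} := by
  have hsurj : Function.Surjective
      fun v : {v : Fin (m + 1) → K // v ⬝ᵥ v ≠ 0} => Fin.tail v.1 := by
    intro u
    have key : ∃ a : K, a * a + u ⬝ᵥ u ≠ 0 := by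
      by_cases hu : u ⬝ᵥ u = 0
      · exact ⟨1, by simp [hu]⟩
      · exact ⟨0, by simpa using hu⟩
    obtain ⟨a, ha⟩ := key
    refine ⟨⟨Fin.cons a u, ?_⟩, by simp⟩
    simpa [dotProduct, Fin.sum_univ_succ] using ha
  simpa using Fintype.card_le_of_surjective _ hsurj

/-! ### Union bound, and passage from sequences to sets. -/

/-- A uniform random `f` restricted along an injection is uniform; this is the resulting bound on
probabilities with denominators cleared. -/
theorem card_comp_mem_mul_le {α ι W : Type*} [Fintype α] [Fintype ι] [DecidableEq ι]
    [DecidableEq α] [Fintype W] (g : α → ι) (hg : Function.Injective g) (P : (α → W) → Prop)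
    [DecidablePred P] :
    (Finset.univ.filter fun f : ι → W => P (f ∘ g)).card * Fintype.card W ^ Fintype.card α ≤
      (Finset.univ.filter P).card * Fintype.card W ^ Fintype.card ι := by
  classical
  have hle : (Finset.univ.filter fun f : ι → W => P (f ∘ g)).card ≤
      (Finset.univ.filter P ×ˢ
        (Finset.univ : Finset ({i // i ∉ Set.range g} → W))).card := by
    refine Finset.card_le_card_of_injOn (fun f => (f ∘ g, fun i => f i)) ?_ ?_
    · intro f hf
      simpa using hf
    · intro f _ f' _ hff
      obtain ⟨h1, h2⟩ := Prod.mk.inj hff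
      funext i
      by_cases hi : i ∈ Set.range g
      · obtain ⟨a, rfl⟩ := hi
        exact congrFun h1 a
      · exact congrFun h2 ⟨i, hi⟩
  refine (Nat.mul_le_mul_right _ hle).trans (le_of_eq ?_)
  have hcard : Fintype.card {i // i ∉ Set.range g} + Fintype.card α = Fintype.card ι := by
    have h1 := Fintype.card_subtype_compl (fun i => i ∈ Set.range g)
    have h2 : Fintype.card {i // i ∈ Set.range g} = Fintype.card α :=
      Set.card_range_of_injective hg
    have h3 := Fintype.card_le_of_injective g hg
    omega
  rw [Finset.card_product, mul_assoc, Finset.card_univ, Fintype.card_fun, ← pow_add, hcard]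

/-- If few pairs of `h`-tuples are completely `R`-related, then some long sequence contains no
completely `R`-related pair of disjoint `h`-tuples. -/
theorem exists_seq_forall_exists_not_rel {W : Type*} [Fintype W] (R : W → W → Prop)
    [DecidableRel R] (h n : ℕ)
    (hlt : n ^ (2 * h) * (Finset.univ.filter fun z : (Fin h → W) × (Fin h → W) =>
      ∀ i j, R (z.1 i) (z.2 j)).card < Fintype.card W ^ (2 * h)) :
    ∃ f : Fin n → W, ∀ g : Fin h ⊕ Fin h → Fin n, Function.Injective g →
      ∃ i j, ¬ R (f (g (Sum.inl i))) (f (g (Sum.inr j))) := by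
  classical
  by_contra! hcon
  let P : (Fin h ⊕ Fin h → W) → Prop := fun z => ∀ i j, R (z (Sum.inl i)) (z (Sum.inr j))
  have hP : (Finset.univ.filter P).card = (Finset.univ.filter
      fun z : (Fin h → W) × (Fin h → W) => ∀ i j, R (z.1 i) (z.2 j)).card := by
    refine Finset.card_equiv (Equiv.sumArrowEquivProdArrow _ _ _) fun z => ?_
    simp [P, Equiv.sumArrowEquivProdArrow]
  have hcover : (Finset.univ : Finset (Fin n → W)) ⊆
      (Finset.univ.filter fun g : Fin h ⊕ Fin h → Fin n => Function.Injective g).biUnion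
        fun g => Finset.univ.filter fun f : Fin n → W => P (f ∘ g) := by
    intro f _
    obtain ⟨g, hg, hR⟩ := hcon f
    simp only [Finset.mem_biUnion, Finset.mem_filter, Finset.mem_univ, true_and]
    exact ⟨g, hg, hR⟩
  have hW : 0 < Fintype.card W := by
    rcases Nat.eq_zero_or_pos (Fintype.card W) with h0 | h0
    · rcases Nat.eq_zero_or_pos h with rfl | hh
      · simp at hlt
      · rw [h0, zero_pow (by omega)] at hlt; omega
    · exact h0
  have h1 : Fintype.card W ^ n * Fintype.card W ^ (2 * h) ≤
      n ^ (2 * h) * ((Finset.univ.filter P).card * Fintype.card W ^ n) := by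
    calc Fintype.card W ^ n * Fintype.card W ^ (2 * h)
        ≤ (∑ g ∈ Finset.univ.filter fun g : Fin h ⊕ Fin h → Fin n => Function.Injective g,
            (Finset.univ.filter fun f : Fin n → W => P (f ∘ g)).card) *
              Fintype.card W ^ (2 * h) := by
          refine Nat.mul_le_mul_right _ ?_
          have := (Finset.card_le_card hcover).trans Finset.card_biUnion_le
          simpa using this
      _ ≤ ∑ g ∈ Finset.univ.filter fun g : Fin h ⊕ Fin h → Fin n => Function.Injective g,
            (Finset.univ.filter P).card * Fintype.card W ^ n := by
          rw [Finset.sum_mul]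
          refine Finset.sum_le_sum fun g hg => ?_
          have := card_comp_mem_mul_le g (Finset.mem_filter.1 hg).2 P
          simpa [two_mul] using this
      _ ≤ _ := by
          rw [Finset.sum_const, smul_eq_mul]
          refine Nat.mul_le_mul_right _ ((Finset.card_le_univ _).trans ?_)
          simp [two_mul]
  rw [hP] at h1
  have h2 := Nat.mul_lt_mul_of_pos_right hlt (Nat.pow_pos (n := n) hW)
  nlinarith

/-- Passing from a sequence of indices to the set of associated vectors. -/
theorem exists_bipartiteNearlyOrthogonal_of_seq {F W : Type*} [Field F] {d k h n : ℕ}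
    (hk : 2 * h ≤ k + 1) (a : W → Fin d → F) (ha : ∀ w, a w ⬝ᵥ a w ≠ 0) (f : Fin n → W)
    (hf : ∀ g : Fin h ⊕ Fin h → Fin n, Function.Injective g →
      ∃ i j, a (f (g (Sum.inl i))) ⬝ᵥ a (f (g (Sum.inr j))) = 0) :
    ∃ A : Finset (Fin d → F), IsBipartiteNearlyOrthogonal k (A : Set (Fin d → F)) ∧
      n ≤ 2 * h * A.card := by
  classical
  refine ⟨Finset.univ.image fun i => a (f i), ⟨?_, ?_⟩, ?_⟩
  · intro v hv
    obtain ⟨i, -, rfl⟩ := Finset.mem_image.1 hv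
    exact ha _
  · intro S₁ S₂ h₁ h₂ c₁ c₂
    have hidx : ∀ v ∈ Finset.univ.image fun i => a (f i), ∃ i, a (f i) = v := by
      intro v hv
      obtain ⟨i, -, hi⟩ := Finset.mem_image.1 hv
      exact ⟨i, hi⟩
    obtain ⟨T₁, hT₁, t₁⟩ := Finset.exists_subset_card_eq (show h ≤ S₁.card by omega)
    -- `S₁` and `S₂` may overlap, while `hf` needs distinct indices; `2 * h ≤ k + 1` leaves room for
    -- disjoint `T₁` and `T₂`.
    have hsd : h ≤ (S₂ \ T₁).card := by
      have := Finset.le_card_sdiff T₁ S₂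
      omega
    obtain ⟨T₂, hT₂, t₂⟩ := Finset.exists_subset_card_eq hsd
    let e₁ := T₁.equivFinOfCardEq t₁
    let e₂ := T₂.equivFinOfCardEq t₂
    let v : Fin h ⊕ Fin h → Fin d → F := Sum.elim (fun i => e₁.symm i) (fun i => e₂.symm i)
    have hv : Function.Injective v := by
      refine Function.Injective.sumElim (Subtype.val_injective.comp e₁.symm.injective)
        (Subtype.val_injective.comp e₂.symm.injective) fun i j hij => ?_
      have := Finset.mem_sdiff.1 (hT₂ (e₂.symm j).2)
      exact this.2 (hij ▸ (e₁.symm i).2)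
    have hmem : ∀ s, v s ∈ Finset.univ.image fun i => a (f i) := by
      rintro (i | j)
      · exact h₁ (hT₁ (e₁.symm i).2)
      · exact h₂ (Finset.mem_sdiff.1 (hT₂ (e₂.symm j).2)).1
    choose g hg using fun s => hidx (v s) (hmem s)
    obtain ⟨i, j, hij⟩ := hf g (fun s s' hss => hv (by rw [← hg s, ← hg s', hss]))
    rw [hg, hg] at hij
    exact ⟨_, hT₁ (e₁.symm i).2, _, (Finset.mem_sdiff.1 (hT₂ (e₂.symm j).2)).1, hij⟩
  · have := Finset.card_le_mul_card_image (s := (Finset.univ : Finset (Fin n)))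
      (f := fun i => a (f i)) (2 * h) ?_
    · simpa using this
    · intro v _
      -- A value taken more than `2 * h` times would fill both tuples of `hf` and be orthogonal to
      -- itself.
      by_contra! hcard
      have : Fintype.card (Fin h ⊕ Fin h) ≤
          Fintype.card (Finset.univ.filter fun i => a (f i) = v) := by
        rw [Fintype.card_coe]; simp; omega
      obtain ⟨e⟩ := Function.Embedding.nonempty_of_card_le this
      obtain ⟨i, j, hij⟩ := hf (fun s => e s) (Subtype.val_injective.comp e.injective)
      have hval : ∀ s, a (f (e s)) = v := fun s => (Finset.mem_filter.1 (e s).2).2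
      rw [hval] at hij
      have := ha (f (e (Sum.inl i)))
      rw [hval] at this
      rw [hval] at hij
      exact this hij

/-! ### Tensor powers and the random construction. -/

/-- Tensor products of `t` vectors of `K ^ m`, as vectors of `F ^ d`. -/
theorem exists_tensor_map {K F : Type*} [Field K] [Field F] (φ : K →+* F) {m t d : ℕ}
    (hd : m ^ t ≤ d) :
    ∃ a : (Fin t → Fin m → K) → Fin d → F, ∀ w w',
      a w ⬝ᵥ a w' = φ (∏ s, w s ⬝ᵥ w' s) := by
  classical
  obtain ⟨e⟩ : Nonempty ((Fin t → Fin m) ↪ Fin d) :=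
    Function.Embedding.nonempty_of_card_le (by simpa using hd)
  -- Padding by `0` outside the range of `e` leaves inner products unchanged.
  refine ⟨fun w => Function.extend e (fun c => φ (∏ s, w s (c s))) 0, fun w w' => ?_⟩
  have hprod : ∏ s, w s ⬝ᵥ w' s = ∑ c : Fin t → Fin m, ∏ s, w s (c s) * w' s (c s) := by
    simp only [dotProduct]
    rw [Finset.prod_univ_sum, Fintype.piFinset_univ]
  rw [hprod, map_sum, dotProduct]
  symm
  refine Finset.sum_of_injOn e e.injective.injOn (by simp) ?_ ?_
  · intro i _ hi
    beta_reduce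
    rw [Function.extend_apply', Pi.zero_apply, zero_mul]
    simpa using hi
  · intro c _
    beta_reduce
    rw [e.injective.extend_apply, e.injective.extend_apply, ← map_mul, Finset.prod_mul_distrib]

/-- This turns the count in dimension `m + 1` into the hypothesis of the union bound. The factor `q
^ (2 * h)` is the price of bounding the number of non-self-orthogonal vectors below by only `q ^ m`.
-/
theorem pow_mul_pow_lt_of_mul_le {n b q r m h t : ℕ} (hq : 0 < q)
    (hb : b * q ^ (h * h) ≤ 2 ^ h * (q ^ (2 * (m + 1) * h) * r))
    (hn : n ^ (2 * h) * (2 ^ h * (q ^ (2 * h) * r)) ^ t < (q ^ (h * h)) ^ t) :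
    n ^ (2 * h) * b ^ t < (q ^ m) ^ (t * (2 * h)) := by
  refine Nat.lt_of_mul_lt_mul_right (a := (q ^ (h * h)) ^ t) ?_
  calc n ^ (2 * h) * b ^ t * (q ^ (h * h)) ^ t = n ^ (2 * h) * (b * q ^ (h * h)) ^ t := by
        rw [mul_pow, mul_assoc]
    _ ≤ n ^ (2 * h) * (2 ^ h * (q ^ (2 * (m + 1) * h) * r)) ^ t :=
        Nat.mul_le_mul_left _ (Nat.pow_le_pow_left hb t)
    _ = n ^ (2 * h) * ((q ^ m) ^ (2 * h) * (2 ^ h * (q ^ (2 * h) * r))) ^ t := by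
        rw [show 2 * (m + 1) * h = m * (2 * h) + 2 * h by ring, pow_add, pow_mul q m]
        congr 2
        ac_rfl
    _ = (q ^ m) ^ (t * (2 * h)) * (n ^ (2 * h) * (2 ^ h * (q ^ (2 * h) * r)) ^ t) := by
        rw [mul_pow ((q ^ m) ^ (2 * h)), ← pow_mul (q ^ m) (2 * h) t, mul_comm t (2 * h)]
        exact Nat.mul_left_comm _ _ _
    _ < (q ^ m) ^ (t * (2 * h)) * (q ^ (h * h)) ^ t :=
        Nat.mul_lt_mul_of_pos_left hn (Nat.pow_pos (Nat.pow_pos hq))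

theorem card_cross_rel_subtype_le {U : Type*} [Fintype U] (Q : U → Prop) [DecidablePred Q]
    (R : U → U → Prop) [DecidableRel R] (h : ℕ) :
    (Finset.univ.filter fun z : (Fin h → {u // Q u}) × (Fin h → {u // Q u}) =>
      ∀ i j, R (z.1 i).1 (z.2 j).1).card ≤
    (Finset.univ.filter fun z : (Fin h → U) × (Fin h → U) => ∀ i j, R (z.1 i) (z.2 j)).card := by
  refine Finset.card_le_card_of_injOn
    (fun z => (fun i => (z.1 i).1, fun i => (z.2 i).1)) ?_ ?_
  · intro z hz
    rw [Finset.mem_coe, Finset.mem_filter] at hz ⊢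
    exact ⟨Finset.mem_univ _, hz.2⟩
  · intro z _ z' _ hzz
    obtain ⟨h1, h2⟩ := Prod.mk.inj hzz
    exact Prod.ext (funext fun i => Subtype.ext (congrFun h1 i))
      (funext fun i => Subtype.ext (congrFun h2 i))

theorem card_cross_rel_pi_le {V : Type*} [Fintype V] (R : V → V → Prop) [DecidableRel R]
    (h t : ℕ) :
    (Finset.univ.filter fun z : (Fin h → Fin t → V) × (Fin h → Fin t → V) =>
      ∀ i j, ∀ s, R (z.1 i s) (z.2 j s)).card ≤
    (Finset.univ.filter fun z : (Fin h → V) × (Fin h → V) =>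
      ∀ i j, R (z.1 i) (z.2 j)).card ^ t := by
  have hpi := Fintype.card_piFinset fun _ : Fin t =>
      Finset.univ.filter fun z : (Fin h → V) × (Fin h → V) => ∀ i j, R (z.1 i) (z.2 j)
  rw [Finset.prod_const, Finset.card_univ, Fintype.card_fin] at hpi
  rw [← hpi]
  refine Finset.card_le_card_of_injOn
    (fun z s => (fun i => z.1 i s, fun i => z.2 i s)) ?_ ?_
  · intro z hz
    rw [Finset.mem_coe, Finset.mem_filter] at hz
    rw [Finset.mem_coe, Fintype.mem_piFinset]
    intro s
    rw [Finset.mem_filter]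
    exact ⟨Finset.mem_univ _, fun i j => hz.2 i j s⟩
  · intro z _ z' _ hzz
    have h1 := fun s => Prod.mk.inj (congrFun hzz s)
    exact Prod.ext (funext fun i => funext fun s => congrFun (h1 s).1 i)
      (funext fun i => funext fun s => congrFun (h1 s).2 i)

theorem exists_bipartiteNearlyOrthogonal_of_pow_lt (K : Type*) {F : Type*} [Field K] [Fintype K]
    [Field F] (φ : K →+* F) {d k m h t n : ℕ} (hk : 2 * h ≤ k + 1) (hm : 2 * h ≤ m + 1)
    (hd : (m + 1) ^ t ≤ d)
    (hn : n ^ (2 * h) * (2 ^ h * (Fintype.card K ^ (2 * h) * (Fintype.card K - 1) ^ (h * h))) ^ t <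
      (Fintype.card K ^ (h * h)) ^ t) :
    ∃ A : Finset (Fin d → F), IsBipartiteNearlyOrthogonal k (A : Set (Fin d → F)) ∧
      n ≤ 2 * h * A.card := by
  classical
  obtain ⟨a, ha⟩ := exists_tensor_map φ hd
  have hne : ∀ w w' : Fin t → {v : Fin (m + 1) → K // v ⬝ᵥ v ≠ 0},
      (∀ s, (w s).1 ⬝ᵥ (w' s).1 ≠ 0) ↔ a (fun s => (w s).1) ⬝ᵥ a (fun s => (w' s).1) ≠ 0 := by
    intro w w'
    rw [ha, map_ne_zero, Finset.prod_ne_zero_iff]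
    simp only [Finset.mem_univ, true_implies]
  have hb := (Nat.mul_le_mul_right (Fintype.card K ^ (h * h)) (card_cross_rel_subtype_le
    (fun v : Fin (m + 1) → K => v ⬝ᵥ v ≠ 0) (fun v w => v ⬝ᵥ w ≠ 0) h)).trans
      (card_cross_nonorthogonal_le hm)
  have hB := card_cross_rel_pi_le
    (fun v w : {v : Fin (m + 1) → K // v ⬝ᵥ v ≠ 0} => v.1 ⬝ᵥ w.1 ≠ 0) h t
  have hlt := (Nat.mul_le_mul_left (n ^ (2 * h)) hB).trans_lt
    (pow_mul_pow_lt_of_mul_le Fintype.card_pos hb hn)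
  have hV := Nat.pow_le_pow_left (pow_le_card_nonselforthogonal K m) (t * (2 * h))
  rw [pow_mul (Fintype.card {v : Fin (m + 1) → K // v ⬝ᵥ v ≠ 0})] at hV
  obtain ⟨f, hf⟩ := exists_seq_forall_exists_not_rel
    (fun w w' : Fin t → {v : Fin (m + 1) → K // v ⬝ᵥ v ≠ 0} =>
      ∀ s, (w s).1 ⬝ᵥ (w' s).1 ≠ 0) h n
    (by rw [Fintype.card_fun, Fintype.card_fin]; exact hlt.trans_le hV)
  refine exists_bipartiteNearlyOrthogonal_of_seq hk (fun w => a fun s => (w s).1)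
    (fun w => (hne w w).1 fun s => (w s).2) f fun g hg => ?_
  obtain ⟨i, j, hij⟩ := hf g hg
  rw [hne] at hij
  exact ⟨i, j, not_not.1 hij⟩

/-! ### Choice of parameters and conclusion. -/

/-- With `L = M * M` and `h = k / 2`, one factor `M ^ (h * t)` absorbs the polynomial `9 h² C` per
tensor factor once `h ≥ h₀`, and the other absorbs the square of the target size. Smaller `k` fall
under `δ * k ≤ 1`. -/
theorem exists_nat_sq_mul_pow_lt (L C : ℝ) (hL : 1 < L) (hC : 1 ≤ C) :
    ∃ δ : ℝ, 0 < δ ∧ ∀ k : ℕ, 2 ≤ k → δ * k ≤ 1 ∨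
      ∀ t : ℕ, 1 ≤ t → ∃ n : ℕ, (n : ℝ) ^ 2 * C ^ t < L ^ (k / 2 * t) ∧
        ((2 * (k / 2) : ℕ) : ℝ) * 2 ^ (2 * t * (δ * k)) ≤ n := by
  set M := √L with hM
  have hM1 : 1 < M := Real.lt_sqrt_of_sq_lt (by simpa using hL)
  have hML : M * M = L := Real.mul_self_sqrt (by linarith)
  have hlim := tendsto_pow_const_div_const_pow_of_one_lt 2 hM1
  obtain ⟨h₀, hh₀⟩ := Filter.eventually_atTop.1
    (hlim.eventually_lt_const (show (0 : ℝ) < 1 / (9 * C) by positivity))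
  have hgrow : ∀ h : ℕ, h₀ ≤ h → 9 * (h : ℝ) ^ 2 * C < M ^ h := by
    intro h hh
    have h1 := hh₀ h hh
    rw [div_lt_div_iff₀ (by positivity) (by positivity)] at h1
    linarith
  have hlogM : 0 < Real.logb 2 M := Real.logb_pos (by norm_num) hM1
  -- `12 = 4 * 3`: squaring the target gives exponent `4 * t * δ * k`, and `k ≤ 3 * h`.
  refine ⟨min (Real.logb 2 M / 12) (1 / (2 * h₀ + 2)), by positivity, fun k hk => ?_⟩
  set δ := min (Real.logb 2 M / 12) (1 / (2 * (h₀ : ℝ) + 2)) with hδ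
  have hδ0 : 0 < δ := by positivity
  have hδ1 : δ ≤ Real.logb 2 M / 12 := min_le_left _ _
  have hδ2 : δ ≤ 1 / (2 * (h₀ : ℝ) + 2) := min_le_right _ _
  rcases lt_or_ge (k / 2) h₀ with hlt | hge
  · left
    have hk' : (k : ℝ) ≤ 2 * h₀ + 2 := by
      have : k ≤ 2 * h₀ + 2 := by omega
      exact_mod_cast this
    calc δ * k ≤ 1 / (2 * (h₀ : ℝ) + 2) * (2 * h₀ + 2) := by gcongr
      _ = 1 := by field_simp
  · right
    intro t ht
    set h := k / 2 with hh
    have hh1 : (1 : ℝ) ≤ h := by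
      have : 1 ≤ h := by omega
      exact_mod_cast this
    have hk3 : (k : ℝ) ≤ 3 * h := by
      have : k ≤ 3 * h := by omega
      exact_mod_cast this
    set X : ℝ := 2 ^ (2 * t * (δ * k)) with hX
    have hX1 : 1 ≤ X := Real.one_le_rpow (by norm_num) (by positivity)
    have hXM : X ^ 2 ≤ M ^ (h * t) := by
      have h2 : (2 : ℝ) ^ (12 * δ) ≤ M := by
        rw [← Real.le_logb_iff_rpow_le (by norm_num) (by linarith)]
        linarith
      calc X ^ 2 = (2 : ℝ) ^ (δ * (4 * t * k)) := by
            rw [hX, ← Real.rpow_natCast, ← Real.rpow_mul (by norm_num)]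
            congr 1; push_cast; ring
        _ ≤ (2 : ℝ) ^ (δ * (4 * t * (3 * h))) := by
            apply Real.rpow_le_rpow_of_exponent_le (by norm_num)
            gcongr
        _ = ((2 : ℝ) ^ (12 * δ)) ^ (h * t) := by
            rw [← Real.rpow_natCast, ← Real.rpow_mul (by norm_num)]
            congr 1; push_cast; ring
        _ ≤ M ^ (h * t) := by gcongr
    refine ⟨⌈((2 * h : ℕ) : ℝ) * X⌉₊, ?_, Nat.le_ceil _⟩
    have hn : (⌈((2 * h : ℕ) : ℝ) * X⌉₊ : ℝ) ≤ 3 * h * X := by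
      have h1 := (Nat.ceil_lt_add_one (show 0 ≤ ((2 * h : ℕ) : ℝ) * X by positivity)).le
      push_cast at h1 ⊢
      nlinarith
    calc (⌈((2 * h : ℕ) : ℝ) * X⌉₊ : ℝ) ^ 2 * C ^ t ≤ (3 * h * X) ^ 2 * C ^ t := by gcongr
      _ = X ^ 2 * (9 * (h : ℝ) ^ 2 * C ^ t) := by ring
      _ ≤ X ^ 2 * ((9 * (h : ℝ) ^ 2) ^ t * C ^ t) := by
          gcongr
          exact le_self_pow₀ (by nlinarith) (by omega)
      _ = X ^ 2 * (9 * (h : ℝ) ^ 2 * C) ^ t := by rw [mul_pow (9 * (h : ℝ) ^ 2) C]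
      _ < X ^ 2 * (M ^ h) ^ t := by
          gcongr
          exact hgrow h hge
      _ ≤ M ^ (h * t) * (M ^ h) ^ t := by gcongr
      _ = L ^ (h * t) := by rw [← hML, mul_pow, pow_mul M h t]

theorem exists_bipartiteNearlyOrthogonal_rpow_le (p : ℕ) (hp : p.Prime) :
    ∃ δ : ℝ, 0 < δ ∧ ∀ (F : Type*) [Field F] [CharP F p] (k d : ℕ), 2 ≤ k → k ≤ d →
      ∃ A : Finset (Fin d → F), IsBipartiteNearlyOrthogonal k (A : Set (Fin d → F)) ∧
        (d : ℝ) ^ (δ * k / Real.logb 2 k) ≤ (A.card : ℝ) := by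
  have hp2 : (2 : ℝ) ≤ p := by exact_mod_cast hp.two_le
  -- These are the `h`-th roots of the quantities in `hcount`: `2 * p ^ 2` from `2 ^ h * p ^ (2 *
  -- h)`, and `(p / (p - 1)) ^ h` from the `h * h` cross conditions.
  obtain ⟨δ, hδ, hmain⟩ := exists_nat_sq_mul_pow_lt (p / (p - 1)) (2 * p ^ 2)
    (by rw [one_lt_div (by linarith)]; linarith) (by nlinarith)
  refine ⟨δ, hδ, fun F _ _ k d hk hkd => ?_⟩
  have hk2 : (2 : ℝ) ≤ k := by exact_mod_cast hk
  have hlog : 1 ≤ Real.logb 2 k := by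
    rw [Real.le_logb_iff_rpow_le (by norm_num) (by linarith)]
    simpa using hk2
  have hd1 : (1 : ℝ) ≤ d := by
    have : 1 ≤ d := by omega
    exact_mod_cast this
  rcases hmain k hk with hsmall | hlarge
  · obtain ⟨A, hA, hcard⟩ := exists_bipartiteNearlyOrthogonal_card_eq_dim F d k (by omega)
    refine ⟨A, hA, ?_⟩
    rw [hcard]
    calc (d : ℝ) ^ (δ * k / Real.logb 2 k) ≤ (d : ℝ) ^ (1 : ℝ) := by
          apply Real.rpow_le_rpow_of_exponent_le hd1
          rw [div_le_one (by linarith)]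
          linarith
      _ = d := Real.rpow_one _
  · have : Fact p.Prime := ⟨hp⟩
    set t := Nat.log k d with ht
    have ht1 : 1 ≤ t := Nat.log_pos (by omega) hkd
    have hkt : k ^ t ≤ d := Nat.pow_log_le_self k (by omega)
    -- `d < k ^ (t + 1)` and `t + 1 ≤ 2 * t`. Since `k = 2 ^ logb 2 k`, the logarithm then cancels
    -- in `hX`.
    have hdt : d ≤ k ^ (2 * t) :=
      (Nat.lt_pow_succ_log_self (by omega) d).le.trans (Nat.pow_le_pow_right (by omega) (by omega))
    obtain ⟨n, hn1, hn2⟩ := hlarge t ht1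
    set h := k / 2 with hh
    have hh1 : 1 ≤ h := by omega
    have hcount : n ^ (2 * h) * (2 ^ h * (Fintype.card (ZMod p) ^ (2 * h) *
        (Fintype.card (ZMod p) - 1) ^ (h * h))) ^ t < (Fintype.card (ZMod p) ^ (h * h)) ^ t := by
      rw [ZMod.card]
      have hpos : (0 : ℝ) < p - 1 := by linarith
      have h1 := pow_lt_pow_left₀ hn1 (by positivity) (show h ≠ 0 by omega)
      have h2 : ((p : ℝ) / (p - 1)) ^ (h * t * h) * (p - 1) ^ (h * h * t) = p ^ (h * h * t) := by
        rw [show h * t * h = h * h * t by ring, ← mul_pow, div_mul_cancel₀ _ hpos.ne']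
      have h3 := mul_lt_mul_of_pos_right h1 (show (0 : ℝ) < (p - 1) ^ (h * h * t) by positivity)
      rw [← pow_mul, h2] at h3
      have h4 : ((p - 1 : ℕ) : ℝ) = p - 1 := by
        rw [Nat.cast_sub hp.one_le, Nat.cast_one]
      rw [← Nat.cast_lt (α := ℝ)]
      push_cast [h4]
      calc _ = ((n : ℝ) ^ 2 * (2 * p ^ 2) ^ t) ^ h * (p - 1) ^ (h * h * t) := by
            simp only [mul_pow, ← pow_mul]
            ring
        _ < _ := h3
        _ = _ := by rw [pow_mul]
    -- Working over the prime field keeps `δ` independent of `F`; `m = k - 1` makes each tensor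
    -- factor `k`-dimensional.
    obtain ⟨A, hA, hcard⟩ := exists_bipartiteNearlyOrthogonal_of_pow_lt (ZMod p)
      (F := F) (ZMod.castHom (dvd_refl p) F) (d := d) (k := k) (m := k - 1) (h := h) (t := t)
      (n := n) (by omega) (by omega) (by rwa [Nat.sub_add_cancel (by omega)]) hcount
    refine ⟨A, hA, ?_⟩
    have hX : (d : ℝ) ^ (δ * k / Real.logb 2 k) ≤ 2 ^ (2 * t * (δ * k)) := by
      calc (d : ℝ) ^ (δ * k / Real.logb 2 k) ≤ ((k : ℝ) ^ (2 * t)) ^ (δ * k / Real.logb 2 k) := by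
            apply Real.rpow_le_rpow (by linarith) (by exact_mod_cast hdt) (by positivity)
        _ = (2 : ℝ) ^ (2 * t * (δ * k)) := by
            have hk' : (k : ℝ) = 2 ^ Real.logb 2 k :=
              (Real.rpow_logb (by norm_num) (by norm_num) (by linarith)).symm
            rw [← Real.rpow_natCast, ← Real.rpow_mul (by linarith)]
            conv_lhs => rw [hk', ← Real.rpow_mul (by norm_num), ← hk']
            congr 1
            push_cast
            field_simp
    have hfin : ((2 * h : ℕ) : ℝ) * 2 ^ (2 * t * (δ * k)) ≤ ((2 * h : ℕ) : ℝ) * A.card :=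
      hn2.trans (by exact_mod_cast hcard)
    exact hX.trans (le_of_mul_le_mul_left hfin (by positivity))

theorem theorem1 (p : ℕ) (hp : p.Prime) :
    ∃ δ : ℝ, 0 < δ ∧
      ∀ (F : Type*) [Field F] [CharP F p] (k d : ℕ), 2 ≤ k → k ≤ d →
        -- the lower bound on `β`
        ENNReal.ofReal ((d : ℝ) ^ (δ * k / Real.logb 2 k)) ≤
            (bipartiteNearlyOrthogonalNumber d k F : ℝ≥0∞) ∧
        -- a set that realizes the bound
        (∃ A : Finset (Fin d → F),
          IsBipartiteNearlyOrthogonal k (A : Set (Fin d → F)) ∧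
            (d : ℝ) ^ (δ * k / Real.logb 2 k) ≤ (A.card : ℝ)) ∧
        -- the same lower bound on `α`
        bipartiteNearlyOrthogonalNumber d k F ≤ nearlyOrthogonalNumber d k F ∧
        ENNReal.ofReal ((d : ℝ) ^ (δ * k / Real.logb 2 k)) ≤
            (nearlyOrthogonalNumber d k F : ℝ≥0∞) ∧
        -- optimality up to the factor `log k` in the exponent
        nearlyOrthogonalNumber d k F < (((d + k).choose k : ℕ) : ℕ∞) ∧
        (d + k).choose k ≤ d ^ (2 * k) := by
  obtain ⟨δ, hδ, hmain⟩ := exists_bipartiteNearlyOrthogonal_rpow_le p hp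
  refine ⟨δ, hδ, fun F _ _ k d hk hkd => ?_⟩
  obtain ⟨A, hA, hcard⟩ := hmain F k d hk hkd
  have hβ : ENNReal.ofReal ((d : ℝ) ^ (δ * k / Real.logb 2 k)) ≤
      (bipartiteNearlyOrthogonalNumber d k F : ℝ≥0∞) := by
    have h1 : ENNReal.ofReal ((d : ℝ) ^ (δ * k / Real.logb 2 k)) ≤ (A.card : ℝ≥0∞) := by
      rw [← ENNReal.ofReal_natCast]
      exact ENNReal.ofReal_le_ofReal hcard
    refine h1.trans ?_
    have := ENat.toENNReal_le.2 hA.card_le_number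
    simpa using this
  have hle := bipartiteNearlyOrthogonalNumber_le d k F
  exact ⟨hβ, ⟨A, hA, hcard⟩, hle, hβ.trans (ENat.toENNReal_le.2 hle),
    nearlyOrthogonalNumber_lt d k F, choose_add_le_pow (by omega)⟩
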